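/- **Notation.** Let $\mathbb H$ be the quaternions, $x=x_0+\vec q$ with $\vec q=x_1\mathbf e_1+x_2\mathbf e_2+x_3\mathbf e_3$, and $\mathbb H^*=\{x\in\mathbb H:\vec q\neq 0\}$. A function $f$ with values in $\mathbb H$ (or, entrywise, in $\mathbb H^{n\times m}$), of class $C^1$ on an open set $\Omega\subset\mathbb H^*$, is called $V_q$-regular on $\Omega$ if $$V_qf=\frac{\partial f}{\partial x_0}-\frac1{\vec q}\sum_{u=1}^3x_u\frac{\partial f}{\partial x_u}=0\quad\text{on }\Omega .$$ For $u=1,2,3$ let $\mu_u(x)=x_u\left(1+\frac{x_0}{\vec q}\right)$, and for $\alpha\in\mathbb N_0^3$ let $\mu^\alpha=\mu_1^{\alpha_1}\mu_2^{\alpha_2}\mu_3^{\alpha_3}$. Let $$\Omega(\mathfrak A)=\Big\{x\in\mathbb H^*:\ \sum_{\alpha\in\mathbb N_0^3}\frac{|\alpha|!}{\alpha!}|\mu^\alpha(x)|^2<\infty\Big\},$$ and let $\mathfrak A^m$ be the space of series $f=\sum_{\alpha\in\mathbb N_0^3}\mu^\alpha c_\alpha$, $c_\alpha\in\mathbb H^m$,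 that converge absolutely on $\Omega(\mathfrak A)$ and satisfy $\|f\|^2=\sum_\alpha\frac{\alpha!}{|\alpha|!}|c_\alpha|^2<\infty$. For $V_q$-regular functions $f,g$ on $\Omega(\mathfrak A)$ (scalar, vector or matrix valued, of compatible sizes) the product $f\star_{V_q}g$ is the $V_q$-regular function on $\Omega(\mathfrak A)$ that coincides with the pointwise product $fg$ at the points of $\Omega(\mathfrak A)$ with $x_0=0$. A $V_q$-regular function $S:\Omega(\mathfrak A)\to\mathbb H^{n\times m}$ is called a contractive multiplier from $\mathfrak A^m$ into $\mathfrak A^n$ if for every $f\in\mathfrak A^m$ one has $S\star_{V_q}f\in\mathfrak A^n$ and $\|S\star_{V_q}f\|\le\|f\|$. An $\mathbb H^{n\times n}$-valued kernel $K$ is called positive definite on $\Omega(\mathfrak A)$ if $\sum_{i,j=1}^N\xi_i^*K(x_i,x_j)\xi_j$ is a non-negative real number for all $N$, all $x_1,\dots,x_N\in\Omega(\mathfrak A)$ and all $\xi_1,\dots,\xi_N\in\mathbb H^n$. **Theorem.** Let $S$ be an $\mathbb H^{n\times m}$-valued $V_q$-regular function on $\Omega(\mathfrak A)$. Then the products $\mu^\alpha\star_{V_q}S$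 exist on $\Omega(\mathfrak A)$, the series $$K(x,y)=\sum_{\alpha\in\mathbb N_0^3}\frac{|\alpha|!}{\alpha!}\left\{\mu^\alpha(x)\overline{\mu^\alpha(y)}\,I_n-\left(\mu^\alpha\star_{V_q}S\right)(x)\left(\mu^\alpha\star_{V_q}S\right)(y)^*\right\}$$ converges absolutely for all $x,y\in\Omega(\mathfrak A)$, and $S$ is a contractive multiplier from $\mathfrak A^m$ into $\mathfrak A^n$ if and only if the kernel $K$ is positive definite on $\Omega(\mathfrak A)$. -/

import Mathlib

open scoped Quaternion Matrix Nat

namespace VqArveson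

noncomputable section

/-- The real coordinates `x₁, x₂, x₃` of the vector part of a quaternion. -/
def coord (u : Fin 3) (x : ℍ[ℝ]) : ℝ := ![x.imI, x.imJ, x.imK] u

/-- The imaginary units `e₁ = i`, `e₂ = j`, `e₃ = k`. -/
def unit (u : Fin 3) : ℍ[ℝ] := ![⟨0, 1, 0, 0⟩, ⟨0, 0, 1, 0⟩, ⟨0, 0, 0, 1⟩] u

/-- `ℍ*`, the quaternions with non-zero vector part. -/
def Hstar : Set ℍ[ℝ] := {x | x.im ≠ 0}

/-- The operator `V_q f = ∂f/∂x₀ - (1/q⃗) ∑ᵤ xᵤ ∂f/∂xᵤ`. -/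
def Vq (f : ℍ[ℝ] → ℍ[ℝ]) (x : ℍ[ℝ]) : ℍ[ℝ] :=
  fderiv ℝ f x 1 - x.im⁻¹ * ∑ u, coord u x • fderiv ℝ f x (unit u)

/-- `f` is `V_q`-regular on the (open) set `Ω`: it is `C¹` there and `V_q f = 0`. -/
def VqRegularOn (f : ℍ[ℝ] → ℍ[ℝ]) (Ω : Set ℍ[ℝ]) : Prop :=
  ContDiffOn ℝ 1 f Ω ∧ ∀ x ∈ Ω, Vq f x = 0

/-- The variables `μᵤ(x) = xᵤ (1 + x₀ / q⃗)`. -/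
def mu (u : Fin 3) (x : ℍ[ℝ]) : ℍ[ℝ] := (coord u x : ℍ[ℝ]) * (1 + (x.re : ℍ[ℝ]) * x.im⁻¹)

/-- The monomials `μ^α = μ₁^α₁ μ₂^α₂ μ₃^α₃`. -/
def muPow (α : Fin 3 → ℕ) (x : ℍ[ℝ]) : ℍ[ℝ] := mu 0 x ^ α 0 * mu 1 x ^ α 1 * mu 2 x ^ α 2

/-- The weight `|α|! / α!`. -/
def weight (α : Fin 3 → ℕ) : ℝ := ((∑ u, α u)! : ℝ) / ∏ u, ((α u)! : ℝ)

/-- The domain `Ω(𝔄)` of the Arveson space. -/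
def OmegaA : Set ℍ[ℝ] := {x | x ∈ Hstar ∧ Summable fun α => ‖muPow α x‖ ^ 2 * weight α}

/-- `F` is the CK-extension to `Ω(𝔄)` of the restriction of `g` to `x₀ = 0`: it is `V_q`-regular
on `Ω(𝔄)` and coincides with `g` at the points where `x₀ = 0`. -/
def IsCKExtension (g F : ℍ[ℝ] → ℍ[ℝ]) : Prop :=
  VqRegularOn F OmegaA ∧ ∀ x ∈ OmegaA, x.re = 0 → F x = g x

open Classical in
/-- The CK-extension to `Ω(𝔄)` of the restriction of `g` to `x₀ = 0`
(with value `0` if there is none). -/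
def ckExtension (g : ℍ[ℝ] → ℍ[ℝ]) : ℍ[ℝ] → ℍ[ℝ] :=
  if h : ∃ F, IsCKExtension g F then h.choose else 0

/-- The CK-product `f ⋆ S` of a scalar function and a matrix-valued function: entry by entry, the
CK-extension of the pointwise product. -/
def starScalar {n m : ℕ} (f : ℍ[ℝ] → ℍ[ℝ]) (S : ℍ[ℝ] → Matrix (Fin n) (Fin m) ℍ[ℝ])
    (x : ℍ[ℝ]) : Matrix (Fin n) (Fin m) ℍ[ℝ] :=
  Matrix.of fun i j => ckExtension (fun y => f y * S y i j) x

/-- `h` is the CK-product `S ⋆ f` on `Ω(𝔄)` of a matrix-valued and a vector-valued function. -/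
def IsStarMulVec {n m : ℕ} (S : ℍ[ℝ] → Matrix (Fin n) (Fin m) ℍ[ℝ])
    (f : ℍ[ℝ] → Fin m → ℍ[ℝ]) (h : ℍ[ℝ] → Fin n → ℍ[ℝ]) : Prop :=
  ∀ i, IsCKExtension (fun x => (S x *ᵥ f x) i) (fun x => h x i)

/-- The space `𝔄^m` of (columns of `m`) series `∑ μ^α c_α`, with quaternionic coefficients on the
right, which converge absolutely on `Ω(𝔄)` and satisfy `∑ (α! / |α|!) |c_α|² < ∞`. -/
structure Arveson (m : ℕ) where
  coeff : (Fin 3 → ℕ) → Fin m → ℍ[ℝ]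
  summable_coeff : Summable fun α => (weight α)⁻¹ * ∑ i, ‖coeff α i‖ ^ 2
  summable_series : ∀ x ∈ OmegaA, ∀ i, Summable fun α => ‖muPow α x * coeff α i‖

/-- The function `x ↦ ∑ μ^α(x) c_α`. -/
def Arveson.eval {m : ℕ} (f : Arveson m) (x : ℍ[ℝ]) (i : Fin m) : ℍ[ℝ] :=
  ∑' α, muPow α x * f.coeff α i

/-- The squared norm `⟨f, f⟩ = ∑ (α! / |α|!) |c_α|²`. -/
def Arveson.normSq {m : ℕ} (f : Arveson m) : ℝ :=
  ∑' α, (weight α)⁻¹ * ∑ i, ‖f.coeff α i‖ ^ 2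

/-- `S` is a contractive multiplier from `𝔄^m` into `𝔄^n`: the operator `f ↦ S ⋆ f` maps `𝔄^m`
into `𝔄^n` and does not increase the norm. -/
def IsContractiveMultiplier {n m : ℕ} (S : ℍ[ℝ] → Matrix (Fin n) (Fin m) ℍ[ℝ]) : Prop :=
  ∀ f : Arveson m, ∃ h : Arveson n, IsStarMulVec S f.eval h.eval ∧ h.normSq ≤ f.normSq

/-- The `α`-th term of the kernel. -/
def kernelTerm {n m : ℕ} (S : ℍ[ℝ] → Matrix (Fin n) (Fin m) ℍ[ℝ]) (x y : ℍ[ℝ])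
    (α : Fin 3 → ℕ) : Matrix (Fin n) (Fin n) ℍ[ℝ] :=
  weight α • ((muPow α x * star (muPow α y)) • (1 : Matrix (Fin n) (Fin n) ℍ[ℝ])
    - starScalar (muPow α) S x * (starScalar (muPow α) S y)ᴴ)

/-- The kernel
`K(x, y) = ∑ (|α|! / α!) {μ^α(x) conj(μ^α(y)) Iₙ - (μ^α ⋆ S)(x) (μ^α ⋆ S)(y)^*}`. -/
def kernel {n m : ℕ} (S : ℍ[ℝ] → Matrix (Fin n) (Fin m) ℍ[ℝ]) (x y : ℍ[ℝ]) :
    Matrix (Fin n) (Fin n) ℍ[ℝ] :=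
  ∑' α, kernelTerm S x y α

/-- A matrix-valued kernel is positive definite on `Ω` if all the quaternionic quadratic forms
`∑ᵢⱼ ξᵢ^* K(xᵢ, xⱼ) ξⱼ` with `xᵢ ∈ Ω` are non-negative real numbers. -/
def IsPositiveDefiniteOn {n : ℕ} (Ω : Set ℍ[ℝ])
    (K : ℍ[ℝ] → ℍ[ℝ] → Matrix (Fin n) (Fin n) ℍ[ℝ]) : Prop :=
  ∀ (N : ℕ) (x : Fin N → ℍ[ℝ]), (∀ i, x i ∈ Ω) → ∀ ξ : Fin N → Fin n → ℍ[ℝ],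
    ∃ r : ℝ, 0 ≤ r ∧ ∑ i, ∑ j, star (ξ i) ⬝ᵥ (K (x i) (x j) *ᵥ ξ j) = (r : ℍ[ℝ])

end

end VqArveson

namespace VqArveson

open Set Filter Topology Finset
open scoped RealInnerProductSpace

/-! Since `∑ |μ_u|² = |x|²`, the multinomial theorem turns `Ω(𝔄)` into the punctured ball `x.im ≠
0`, `‖x‖ < 1` (`mem_OmegaA`). The equation `V_q f = 0` is the Cauchy–Riemann equation on each
half-plane `{a + bI : b > 0}`, with `I` acting by left multiplication. Hence a regular function is
determined by its values at `x₀ = 0` (`VqRegularOn.eqOn_of_eq_on_re_eq_zero`). As `μ^α` commutes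
with `x.im`, the pointwise product `μ^α S` is already regular, so it is the CK-product. At `x₀ = 0`
the monomials are real, and therefore `S ⋆ f = ∑ μ^α S c_α` (`Arveson.isStarMulVec_starEval`).

The rest is reproducing-kernel duality in a real Hilbert space of normalised coefficients. The
vector `kernelVec A x ξ` represents the real part of the pairing of `∑ μ^α(x) A c_α` with `ξ`. The
quadratic form of `K` equals `‖∑ kernelVec 1‖² - ‖∑ kernelVec S‖²` (`kernel_quadratic_form`), so
positivity is a norm inequality between two families of vectors. Contractivity gives it by testing
the multiplier on the smaller sum and using Cauchy–Schwarz. Conversely, the inequality makes a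
functional well defined and bounded, and Hahn–Banach with Riesz produces the coefficients of `S ⋆ f`
(`exists_inner_eq_of_norm_le`). -/

/-! ### Multinomial weights and the shape of the domain. -/

theorem weight_eq_multinomial (α : Fin 3 → ℕ) :
    weight α = (Nat.multinomial Finset.univ α : ℝ) := by
  have h := Nat.multinomial_spec Finset.univ α
  have h0 : (∏ u, ((α u)! : ℝ)) ≠ 0 :=
    Finset.prod_ne_zero_iff.2 fun u _ => by exact_mod_cast Nat.factorial_ne_zero _
  rw [weight, div_eq_iff h0, ← h]
  push_cast
  ring

theorem weight_pos (α : Fin 3 → ℕ) : 0 < weight α := by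
  rw [weight]
  positivity

/-- Multi-indices are sorted by their length. -/
def sigmaPiAntidiagEquiv :
    (Σ k : ℕ, ↥(Finset.piAntidiag (Finset.univ : Finset (Fin 3)) k)) ≃ (Fin 3 → ℕ) where
  toFun p := p.2.1
  invFun α := ⟨∑ u, α u, α, by simp⟩
  left_inv := by
    rintro ⟨k, α, h⟩
    obtain rfl : ∑ u, α u = k := (Finset.mem_piAntidiag.1 h).1
    rfl
  right_inv _ := rfl

/-- The terms with `|α| = k` add up by the multinomial theorem. The factor `p` leaves room for the
polynomial growth caused by differentiation. -/
theorem summable_weight_mul_iff {b : Fin 3 → ℝ} (hb : ∀ u, 0 ≤ b u) {p : ℕ → ℝ}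
    (hp : ∀ k, 0 ≤ p k) :
    (Summable fun α : Fin 3 → ℕ => p (∑ u, α u) * (weight α * ∏ u, b u ^ α u)) ↔
      Summable fun k => p k * (∑ u, b u) ^ k := by
  rw [← sigmaPiAntidiagEquiv.summable_iff, summable_sigma_of_nonneg]
  · have key : ∀ k, ∑' y : ↥(Finset.piAntidiag (Finset.univ : Finset (Fin 3)) k),
        ((fun α : Fin 3 → ℕ => p (∑ u, α u) * (weight α * ∏ u, b u ^ α u)) ∘
          sigmaPiAntidiagEquiv) ⟨k, y⟩ = p k * (∑ u, b u) ^ k := by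
      intro k
      rw [Finset.sum_pow_eq_sum_piAntidiag, Finset.mul_sum, tsum_fintype,
        ← Finset.sum_coe_sort (Finset.piAntidiag _ k)]
      refine Finset.sum_congr rfl fun y _ => ?_
      have := (Finset.mem_piAntidiag.1 y.2).1
      simp [sigmaPiAntidiagEquiv, this, weight_eq_multinomial]
    constructor
    · intro h
      simpa only [key] using h.2
    · intro h
      exact ⟨fun k => (hasSum_fintype _).summable, by simpa only [key] using h⟩
  · intro x
    exact mul_nonneg (hp _) (mul_nonneg (weight_pos _).le
      (Finset.prod_nonneg fun u _ => pow_nonneg (hb u) _))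

theorem sum_coord_smul_unit (x : ℍ[ℝ]) : ∑ u, coord u x • unit u = x.im := by
  rw [Fin.sum_univ_three]
  ext
  all_goals
    simp only [Quaternion.re_add, Quaternion.imI_add, Quaternion.imJ_add, Quaternion.imK_add,
      Quaternion.re_smul, Quaternion.imI_smul, Quaternion.imJ_smul, Quaternion.imK_smul]
    simp [coord, unit]

theorem sum_coord_sq (x : ℍ[ℝ]) : ∑ u, coord u x ^ 2 = ‖x.im‖ ^ 2 := by
  rw [sq ‖x.im‖, ← Quaternion.normSq_eq_norm_mul_self, Quaternion.normSq_def']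
  simp [Fin.sum_univ_three, coord]

theorem mu_eq_smul (u : Fin 3) (x : ℍ[ℝ]) :
    mu u x = coord u x • ((1 : ℍ[ℝ]) + x.re • x.im⁻¹) := by
  rw [mu, Quaternion.coe_mul_eq_smul, Quaternion.coe_mul_eq_smul]

/-- Multiplying `μ_u` on the right by the vector part clears the inverse and leaves `x_u x`. -/
theorem norm_mu_mul (u : Fin 3) {x : ℍ[ℝ]} (hx : x ∈ Hstar) :
    ‖mu u x‖ * ‖x.im‖ = |coord u x| * ‖x‖ := by
  have hx' : x.im ≠ 0 := hx
  rw [← norm_mul, mu, mul_assoc, add_mul, mul_assoc, inv_mul_cancel₀ hx', one_mul, mul_one,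
    add_comm, Quaternion.re_add_im, norm_mul, Quaternion.norm_coe, Real.norm_eq_abs]

theorem sum_norm_mu_sq {x : ℍ[ℝ]} (hx : x ∈ Hstar) : ∑ u, ‖mu u x‖ ^ 2 = ‖x‖ ^ 2 := by
  have h0 : ‖x.im‖ ^ 2 ≠ 0 := pow_ne_zero _ (norm_ne_zero_iff.2 hx)
  apply mul_right_cancel₀ h0
  rw [Finset.sum_mul]
  simp_rw [← mul_pow, norm_mu_mul _ hx, mul_pow, sq_abs]
  rw [← Finset.sum_mul, sum_coord_sq, mul_comm]

theorem norm_muPow (α : Fin 3 → ℕ) (x : ℍ[ℝ]) : ‖muPow α x‖ = ∏ u, ‖mu u x‖ ^ α u := by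
  simp [muPow, Fin.prod_univ_three]

theorem mem_OmegaA {x : ℍ[ℝ]} : x ∈ OmegaA ↔ x.im ≠ 0 ∧ ‖x‖ < 1 := by
  refine and_congr_right fun hx => ?_
  have h := summable_weight_mul_iff (b := fun u => ‖mu u x‖ ^ 2) (fun u => by positivity)
    (p := fun _ => 1) (fun _ => zero_le_one)
  simp only [one_mul, sum_norm_mu_sq hx] at h
  have e : (fun α : Fin 3 → ℕ => ‖muPow α x‖ ^ 2 * weight α)
      = fun α => weight α * ∏ u, (‖mu u x‖ ^ 2) ^ α u := by
    funext α
    rw [norm_muPow, mul_comm, ← Finset.prod_pow]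
    simp_rw [← pow_mul, mul_comm]
  rw [e, h, summable_geometric_iff_norm_lt_one]
  simp

theorem summable_weight_mul_norm_sq {x : ℍ[ℝ]} (hx : x ∈ OmegaA) :
    Summable fun α => weight α * ‖muPow α x‖ ^ 2 := by
  simpa only [mul_comm] using hx.2

theorem isOpen_OmegaA : IsOpen OmegaA := by
  have : OmegaA = {x | x.im ≠ 0} ∩ {x | ‖x‖ < 1} := Set.ext fun x => mem_OmegaA
  rw [this]
  exact (isOpen_ne_fun Quaternion.continuous_im continuous_const).inter
    (isOpen_lt continuous_norm continuous_const)

/-! ### Regularity of products and monomials. -/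

theorem Vq_eq_zero_iff (f : ℍ[ℝ] → ℍ[ℝ]) {x : ℍ[ℝ]} (hx : x.im ≠ 0) :
    Vq f x = 0 ↔ fderiv ℝ f x x.im = x.im * fderiv ℝ f x 1 := by
  have : ∑ u, coord u x • fderiv ℝ f x (unit u) = fderiv ℝ f x x.im := by
    conv_rhs => rw [← sum_coord_smul_unit x]
    simp only [map_sum, map_smul]
  rw [Vq, this, sub_eq_zero]
  constructor
  · intro h
    rw [h, mul_inv_cancel_left₀ hx]
  · intro h
    rw [h, inv_mul_cancel_left₀ hx]

/-- In the Leibniz rule the vector part appears between `g` and the derivative of `f`; commutation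
with the left factor is all that is needed to bring it to the front. -/
theorem VqRegularOn.mul {f g : ℍ[ℝ] → ℍ[ℝ]} {Ω : Set ℍ[ℝ]} (hΩ : IsOpen Ω) (hΩ' : Ω ⊆ Hstar)
    (hg : VqRegularOn g Ω) (hf : VqRegularOn f Ω) (hc : ∀ x ∈ Ω, Commute x.im (g x)) :
    VqRegularOn (fun x => g x * f x) Ω := by
  refine ⟨hg.1.mul hf.1, fun x hx => ?_⟩
  have hd : DifferentiableAt ℝ g x :=
    (hg.1.contDiffAt (hΩ.mem_nhds hx)).differentiableAt one_ne_zero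
  have hd' : DifferentiableAt ℝ f x :=
    (hf.1.contDiffAt (hΩ.mem_nhds hx)).differentiableAt one_ne_zero
  have h1 := (Vq_eq_zero_iff g (hΩ' hx)).1 (hg.2 x hx)
  have h2 := (Vq_eq_zero_iff f (hΩ' hx)).1 (hf.2 x hx)
  rw [Vq_eq_zero_iff _ (hΩ' hx), fderiv_fun_mul' hd hd']
  simp only [add_apply, FunLike.coe_smul, Pi.smul_apply, smul_eq_mul,
    MulOpposite.smul_eq_mul_unop, MulOpposite.unop_op, h1, h2]
  rw [← mul_assoc, ← (hc x hx).eq]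
  noncomm_ring

theorem commute_im_mu (u : Fin 3) (x : ℍ[ℝ]) : Commute x.im (mu u x) := by
  have h : ∀ r : ℝ, Commute x.im (r : ℍ[ℝ]) := fun r => (Quaternion.coe_commutes r x.im).symm
  exact (h _).mul_right ((Commute.one_right _).add_right ((h _).mul_right
    (Commute.refl x.im).inv_right₀))

theorem contDiff_coord (u : Fin 3) : ContDiff ℝ 1 (coord u) := by
  have h : IsLinearMap ℝ (coord u) :=
    ⟨fun x y => by fin_cases u <;> simp [coord], fun r x => by fin_cases u <;> simp [coord]⟩
  exact (LinearMap.toContinuousLinearMap h.mk').contDiff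

theorem contDiffOn_mu (u : Fin 3) : ContDiffOn ℝ 1 (mu u) Hstar := by
  have hre : ContDiff ℝ 1 (fun x : ℍ[ℝ] => x.re) := by
    have h : IsLinearMap ℝ (fun x : ℍ[ℝ] => x.re) :=
      ⟨fun _ _ => Quaternion.re_add _ _, fun _ _ => Quaternion.re_smul _ _⟩
    exact (LinearMap.toContinuousLinearMap h.mk').contDiff
  have him : ContDiff ℝ 1 (fun x : ℍ[ℝ] => x.im) := by
    have : (fun x : ℍ[ℝ] => x.im) = fun x => ∑ u, coord u x • unit u :=
      funext fun x => (sum_coord_smul_unit x).symm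
    rw [this]
    exact ContDiff.sum fun v _ => (contDiff_coord v).smul contDiff_const
  have hcoe : ContDiff ℝ 1 (fun r : ℝ => (r : ℍ[ℝ])) :=
    (LinearMap.toContinuousLinearMap (Algebra.linearMap ℝ ℍ[ℝ])).contDiff
  intro x hx
  apply ContDiffAt.contDiffWithinAt
  have hinv : ContDiffAt ℝ 1 (fun x : ℍ[ℝ] => x.im⁻¹) x := by
    have h := contDiffAt_ringInverse ℝ (n := 1) (Units.mk0 x.im hx)
    simp only [Ring.inverse_eq_inv'] at h
    exact ContDiffAt.comp x h him.contDiffAt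
  exact (hcoe.comp (contDiff_coord u)).contDiffAt.mul
    (contDiffAt_const.add ((hcoe.comp hre).contDiffAt.mul hinv))

theorem isOpen_Hstar : IsOpen Hstar :=
  isOpen_ne_fun Quaternion.continuous_im continuous_const

theorem fderiv_eq_of_line {f : ℍ[ℝ] → ℍ[ℝ]} {x v w : ℍ[ℝ]} (hf : DifferentiableAt ℝ f x)
    (h : (fun t : ℝ => f (x + t • v)) =ᶠ[𝓝 0] fun t => f x + t • w) : fderiv ℝ f x v = w := by
  rw [← hf.lineDeriv_eq_fderiv, lineDeriv, h.deriv_eq]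
  have : HasDerivAt (fun t : ℝ => f x + t • w) ((1 : ℝ) • w) 0 :=
    ((hasDerivAt_id (0 : ℝ)).smul_const w).const_add _
  rw [this.deriv, one_smul]

/-- Along the directions `1` and `x.im` the function is affine near `x`: scaling the vector part by
`1 + t` cancels in `x_u / q`. Both derivatives can thus be read off. -/
theorem VqRegularOn_mu (u : Fin 3) : VqRegularOn (mu u) Hstar := by
  refine ⟨contDiffOn_mu u, fun x hx => ?_⟩
  have hx' : x.im ≠ 0 := hx
  have hd : DifferentiableAt ℝ (mu u) x :=
    ((contDiffOn_mu u).contDiffAt (isOpen_Hstar.mem_nhds hx)).differentiableAt one_ne_zero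
  have hc1 : ∀ t : ℝ, coord u (x + t • 1) = coord u x := by
    intro t
    fin_cases u <;> simp [coord]
  have hc2 : ∀ t : ℝ, coord u (x + t • x.im) = (1 + t) * coord u x := by
    intro t
    fin_cases u <;> simp [coord] <;> ring
  have h1 : fderiv ℝ (mu u) x 1 = coord u x • x.im⁻¹ := by
    refine fderiv_eq_of_line hd (Eventually.of_forall fun t => ?_)
    have hi : (x + t • (1 : ℍ[ℝ])).im = x.im := by ext <;> simp
    have hr : (x + t • (1 : ℍ[ℝ])).re = x.re + t := by simp
    simp only [mu_eq_smul, hc1, hi, hr]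
    module
  have h2 : fderiv ℝ (mu u) x x.im = coord u x • (1 : ℍ[ℝ]) := by
    refine fderiv_eq_of_line hd ?_
    have hev : ∀ᶠ t : ℝ in 𝓝 0, 1 + t ≠ 0 := by
      have : ContinuousAt (fun t : ℝ => 1 + t) 0 := by fun_prop
      exact this.eventually_ne (by simp)
    filter_upwards [hev] with t ht
    have hi : (x + t • x.im).im = (1 + t) • x.im := by
      ext <;> simp <;> ring
    have hr : (x + t • x.im).re = x.re := by simp
    simp only [mu_eq_smul, hc2, hi, hr, smul_inv₀]
    match_scalars <;> field_simp
  rw [Vq_eq_zero_iff _ hx', h1, h2, mul_smul_comm, mul_inv_cancel₀ hx']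

theorem OmegaA_subset_Hstar : OmegaA ⊆ Hstar := fun _ hx => hx.1

theorem VqRegularOn.muPow_mul {f : ℍ[ℝ] → ℍ[ℝ]} (hf : VqRegularOn f OmegaA) (α : Fin 3 → ℕ) :
    VqRegularOn (fun x => muPow α x * f x) OmegaA := by
  have hm : ∀ u, VqRegularOn (mu u) OmegaA := fun u =>
    ⟨(VqRegularOn_mu u).1.mono OmegaA_subset_Hstar,
      fun x hx => (VqRegularOn_mu u).2 x (OmegaA_subset_Hstar hx)⟩
  have hp : ∀ (u : Fin 3) (k : ℕ) {g : ℍ[ℝ] → ℍ[ℝ]}, VqRegularOn g OmegaA →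
      VqRegularOn (fun x => mu u x ^ k * g x) OmegaA := by
    intro u k g hg
    induction k with
    | zero => simpa using hg
    | succ k ih =>
      have := (hm u).mul isOpen_OmegaA OmegaA_subset_Hstar ih fun x _ => commute_im_mu u x
      simpa only [← mul_assoc, ← pow_succ'] using this
  simpa only [muPow, mul_assoc] using hp 0 (α 0) (hp 1 (α 1) (hp 2 (α 2) hf))

theorem exists_muPow_eq_coe (α : Fin 3 → ℕ) {x : ℍ[ℝ]} (hx : x.re = 0) :
    ∃ r : ℝ, muPow α x = r := by
  refine ⟨coord 0 x ^ α 0 * coord 1 x ^ α 1 * coord 2 x ^ α 2, ?_⟩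
  simp [muPow, mu, hx]

/-! ### Derivative bounds and termwise differentiation. -/

section Generic

variable {E A F : Type*} [NormedAddCommGroup E] [NormedSpace ℝ E] [NormedRing A]
  [NormedAlgebra ℝ A] [NormedAddCommGroup F] [NormedSpace ℝ F]

/-- Bounds at a point for a function and its derivative, the latter of logarithmic degree `k`. -/
def DerivBound (f : E → F) (x : E) (a k M : ℝ) : Prop :=
  DifferentiableAt ℝ f x ∧ ‖f x‖ ≤ a ∧ ‖fderiv ℝ f x‖ ≤ k * a * M

/-- Sup bounds multiply and degrees add, so a product of many factors has a derivative bound that is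
only linear in the number of factors. -/
theorem DerivBound.mul {f g : E → A} {x : E} {a b k l M : ℝ}
    (hf : DerivBound f x a k M) (hg : DerivBound g x b l M) :
    DerivBound (fun y => f y * g y) x (a * b) (k + l) M := by
  obtain ⟨df, f0, f1⟩ := hf
  obtain ⟨dg, g0, g1⟩ := hg
  have hA : 0 ≤ a := (norm_nonneg _).trans f0
  have hB : 0 ≤ b := (norm_nonneg _).trans g0
  have hk : 0 ≤ k * a * M := (norm_nonneg _).trans f1
  refine ⟨df.mul dg, (norm_mul_le _ _).trans (by gcongr), ?_⟩
  rw [fderiv_fun_mul' df dg]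
  have h : ‖f x • fderiv ℝ g x + MulOpposite.op (g x) • fderiv ℝ f x‖ ≤
      ‖f x‖ * ‖fderiv ℝ g x‖ + ‖fderiv ℝ f x‖ * ‖g x‖ := by
    refine ContinuousLinearMap.opNorm_le_bound _ (by positivity) fun v => ?_
    calc ‖f x * fderiv ℝ g x v + fderiv ℝ f x v * g x‖
        ≤ ‖f x‖ * (‖fderiv ℝ g x‖ * ‖v‖) + ‖fderiv ℝ f x‖ * ‖v‖ * ‖g x‖ :=
          (norm_add_le _ _).trans (add_le_add
            ((norm_mul_le _ _).trans (by gcongr; exact ContinuousLinearMap.le_opNorm _ _))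
            ((norm_mul_le _ _).trans (by gcongr; exact ContinuousLinearMap.le_opNorm _ _)))
      _ = _ := by ring
  calc _ ≤ ‖f x‖ * ‖fderiv ℝ g x‖ + ‖fderiv ℝ f x‖ * ‖g x‖ := h
    _ ≤ a * (l * b * M) + (k * a * M) * b := by gcongr
    _ = _ := by ring

theorem DerivBound.const (c : F) (x : E) (M : ℝ) : DerivBound (fun _ => c) x ‖c‖ 0 M :=
  ⟨differentiableAt_const _, le_rfl, by simp⟩

theorem DerivBound.pow [NormOneClass A] {f : E → A} {x : E} {a k M : ℝ}
    (hf : DerivBound f x a k M) (n : ℕ) :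
    DerivBound (fun y => f y ^ n) x (a ^ n) (n * k) M := by
  induction n with
  | zero => simpa using DerivBound.const (1 : A) x M
  | succ n ih =>
    have := ih.mul hf
    simp only [← pow_succ] at this
    convert this using 1
    push_cast
    ring

theorem eventually_derivBound {f : E → F} {Ω : Set E} (hΩ : IsOpen Ω)
    (hf : ContDiffOn ℝ 1 f Ω) {x : E} (hx : x ∈ Ω) {a : ℝ} (ha : ‖f x‖ < a) :
    ∃ M₀, ∀ M ≥ M₀, ∀ᶠ y in 𝓝 x, DerivBound f y a 1 M := by
  have ha0 : 0 < a := (norm_nonneg _).trans_lt ha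
  refine ⟨(‖fderiv ℝ f x‖ + 1) / a, fun M hM => ?_⟩
  have h1 : ∀ᶠ y in 𝓝 x, ‖f y‖ < a :=
    ((hf.continuousOn.continuousAt (hΩ.mem_nhds hx)).norm).eventually_lt_const ha
  have h2 : ∀ᶠ y in 𝓝 x, ‖fderiv ℝ f y‖ < ‖fderiv ℝ f x‖ + 1 :=
    (((hf.continuousOn_fderiv_of_isOpen hΩ le_rfl).continuousAt
      (hΩ.mem_nhds hx)).norm).eventually_lt_const (lt_add_one _)
  filter_upwards [h1, h2, hΩ.mem_nhds hx] with y y1 y2 y3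
  refine ⟨(hf.contDiffAt (hΩ.mem_nhds y3)).differentiableAt one_ne_zero, y1.le, y2.le.trans ?_⟩
  rw [ge_iff_le, div_le_iff₀ ha0] at hM
  linarith

/-- A locally uniform summable majorant of the derivatives suffices. The `HasSum` conclusion lets a
linear differential equation pass to the sum. -/
theorem contDiffOn_tsum_of_locally_bounded_fderiv [CompleteSpace F] {ι : Type*} {t : ι → E → F}
    {Ω : Set E} (hΩ : IsOpen Ω) (hterm : ∀ i, ContDiffOn ℝ 1 (t i) Ω)
    (hsum : ∀ x ∈ Ω, Summable fun i => t i x)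
    (hloc : ∀ x ∈ Ω, ∃ r > 0, Metric.ball x r ⊆ Ω ∧ ∃ v : ι → ℝ, Summable v ∧
      ∀ i, ∀ y ∈ Metric.ball x r, ∃ a k M, DerivBound (t i) y a k M ∧ k * a * M ≤ v i) :
    ContDiffOn ℝ 1 (fun x => ∑' i, t i x) Ω ∧ ∀ x ∈ Ω, ∀ w,
      HasSum (fun i => fderiv ℝ (t i) x w) (fderiv ℝ (fun x => ∑' i, t i x) x w) := by
  have hd : ∀ x ∈ Ω, HasFDerivAt (fun x => ∑' i, t i x) (∑' i, fderiv ℝ (t i) x) x ∧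
      (Summable fun i => fderiv ℝ (t i) x) ∧
      ContinuousAt (fun y => ∑' i, fderiv ℝ (t i) y) x := by
    intro x hx
    obtain ⟨r, hr, hball, v, hv, hvb'⟩ := hloc x hx
    have hvb : ∀ i, ∀ y ∈ Metric.ball x r, ‖fderiv ℝ (t i) y‖ ≤ v i := fun i y hy => by
      obtain ⟨a, k, M, h, h'⟩ := hvb' i y hy
      exact h.2.2.trans h'
    have hxr := Metric.mem_ball_self (x := x) hr
    have hdt : ∀ i, ∀ y ∈ Metric.ball x r, HasFDerivAt (t i) (fderiv ℝ (t i) y) y :=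
      fun i y hy => (((hterm i).contDiffAt (hΩ.mem_nhds (hball hy))).differentiableAt
        one_ne_zero).hasFDerivAt
    have hct : ∀ i, ContinuousOn (fderiv ℝ (t i)) (Metric.ball x r) :=
      fun i => ((hterm i).continuousOn_fderiv_of_isOpen hΩ le_rfl).mono hball
    refine ⟨?_, ?_, ?_⟩
    · exact hasFDerivAt_tsum_of_isPreconnected hv Metric.isOpen_ball
        (convex_ball x r).isPreconnected hdt hvb hxr (hsum x hx) hxr
    · exact Summable.of_norm_bounded hv fun i => hvb i x hxr
    · exact (continuousOn_tsum hct hv hvb).continuousAt (Metric.ball_mem_nhds x hr)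
  refine ⟨fun x hx => ContDiffAt.contDiffWithinAt (contDiffAt_one_iff.2
    ⟨_, Ω, hΩ.mem_nhds hx,
      fun y hy => (hd y hy).2.2.continuousWithinAt, fun y hy => (hd y hy).1⟩), fun x hx w => ?_⟩
  rw [(hd x hx).1.fderiv]
  exact (ContinuousLinearMap.apply ℝ F w).hasSum (hd x hx).2.1.hasSum

end Generic

/-! ### Regularity of the series `∑ μ^α s c_α`. -/

theorem summable_mul_norm_of_weight {ι : Type*} {w t : ι → ℝ} {c : ι → ℍ[ℝ]}
    (hw : ∀ i, 0 < w i) (ht : Summable fun i => w i * t i ^ 2)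
    (hc : Summable fun i => (w i)⁻¹ * ‖c i‖ ^ 2) : Summable fun i => t i * ‖c i‖ := by
  refine Summable.of_norm_bounded (ht.add hc) fun i => ?_
  have h := hw i
  rw [Real.norm_eq_abs, abs_mul, abs_norm]
  have h2 := sq_nonneg (w i * |t i| - ‖c i‖)
  -- Weighted arithmetic–geometric mean inequality, with the defect written as a square.
  have h3 : w i * t i ^ 2 + (w i)⁻¹ * ‖c i‖ ^ 2 - 2 * (|t i| * ‖c i‖)
      = (w i)⁻¹ * (w i * |t i| - ‖c i‖) ^ 2 := by
    rw [← sq_abs (t i)]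
    field_simp
    ring
  have h4 : 0 ≤ (w i)⁻¹ * (w i * |t i| - ‖c i‖) ^ 2 := by positivity
  have h5 : 0 ≤ |t i| * ‖c i‖ := by positivity
  linarith

theorem summable_weight_mul_sq {b : Fin 3 → ℝ} (hb : ∑ u, b u ^ 2 < 1) :
    Summable fun α : Fin 3 → ℕ => weight α * (((∑ u, α u : ℕ) + 1 : ℝ) * ∏ u, b u ^ α u) ^ 2 := by
  have h := (summable_weight_mul_iff (b := fun u => b u ^ 2) (fun u => sq_nonneg _)
    (p := fun k => ((k : ℝ) + 1) ^ 2) (fun k => sq_nonneg _)).2 ?_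
  · refine h.congr fun α => ?_
    rw [mul_pow, ← Finset.prod_pow]
    simp_rw [← pow_mul, mul_comm 2]
    ring
  · set r := ∑ u, b u ^ 2
    have hr : ‖r‖ < 1 := by
      rw [Real.norm_of_nonneg (Finset.sum_nonneg fun u _ => sq_nonneg _)]
      exact hb
    have h2 := summable_pow_mul_geometric_of_norm_lt_one 2 hr
    have h1 := summable_pow_mul_geometric_of_norm_lt_one 1 hr
    have h0 := summable_geometric_of_norm_lt_one hr
    refine ((h2.add (h1.mul_left 2)).add h0).congr fun k => ?_
    ring

/-- The strict inequality `∑ |μ_u(x)|² = |x|² < 1` survives a small enlargement; the slack gives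
bounds valid on a whole neighbourhood. -/
theorem exists_bounds_of_mem_OmegaA {x : ℍ[ℝ]} (hx : x ∈ OmegaA) :
    ∃ b : Fin 3 → ℝ, (∀ u, ‖mu u x‖ < b u) ∧ ∑ u, b u ^ 2 < 1 := by
  have h1 : ContinuousAt (fun ε : ℝ => ∑ u, (‖mu u x‖ + ε) ^ 2) 0 := by fun_prop
  have h2 : ∑ u, (‖mu u x‖ + 0) ^ 2 < 1 := by
    have := (mem_OmegaA.1 hx).2
    simp only [add_zero, sum_norm_mu_sq hx.1]
    nlinarith [norm_nonneg x]
  have h3 : ∀ᶠ ε : ℝ in 𝓝[>] 0, ∑ u, (‖mu u x‖ + ε) ^ 2 < 1 :=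
    (h1.eventually_lt_const h2).filter_mono nhdsWithin_le_nhds
  obtain ⟨ε, h, hε⟩ := (h3.and self_mem_nhdsWithin).exists
  exact ⟨fun u => ‖mu u x‖ + ε, fun u => lt_add_of_pos_right _ hε, h⟩

theorem summable_muPow_mul {x : ℍ[ℝ]} (hx : x ∈ OmegaA) (s : ℍ[ℝ]) {c : (Fin 3 → ℕ) → ℍ[ℝ]}
    (hc : Summable fun α => (weight α)⁻¹ * ‖c α‖ ^ 2) :
    Summable fun α => ‖muPow α x * s * c α‖ := by
  have := (summable_mul_norm_of_weight weight_pos (summable_weight_mul_norm_sq hx) hc).mul_left ‖s‖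
  refine this.congr fun α => ?_
  rw [norm_mul, norm_mul]
  ring

theorem VqRegularOn.tsum {ι : Type*} {t : ι → ℍ[ℝ] → ℍ[ℝ]} {Ω : Set ℍ[ℝ]} (hΩ : IsOpen Ω)
    (hΩ' : Ω ⊆ Hstar) (hterm : ∀ i, VqRegularOn (t i) Ω)
    (hsum : ∀ x ∈ Ω, Summable fun i => t i x)
    (hloc : ∀ x ∈ Ω, ∃ r > 0, Metric.ball x r ⊆ Ω ∧ ∃ v : ι → ℝ, Summable v ∧
      ∀ i, ∀ y ∈ Metric.ball x r, ∃ a k M, DerivBound (t i) y a k M ∧ k * a * M ≤ v i) :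
    VqRegularOn (fun x => ∑' i, t i x) Ω := by
  obtain ⟨h1, h2⟩ := contDiffOn_tsum_of_locally_bounded_fderiv hΩ (fun i => (hterm i).1) hsum hloc
  refine ⟨h1, fun x hx => ?_⟩
  rw [Vq_eq_zero_iff _ (hΩ' hx)]
  have h3 : (fun i => fderiv ℝ (t i) x x.im) = fun i => x.im * fderiv ℝ (t i) x 1 :=
    funext fun i => (Vq_eq_zero_iff _ (hΩ' hx)).1 ((hterm i).2 x hx)
  exact (h3 ▸ h2 x hx x.im).unique ((h2 x hx 1).mul_left x.im)

theorem VqRegularOn.mul_const {f : ℍ[ℝ] → ℍ[ℝ]} {Ω : Set ℍ[ℝ]} (hΩ : IsOpen Ω)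
    (hΩ' : Ω ⊆ Hstar) (hf : VqRegularOn f Ω) (c : ℍ[ℝ]) :
    VqRegularOn (fun x => f x * c) Ω := by
  refine ⟨hf.1.mul contDiffOn_const, fun x hx => ?_⟩
  have hd : DifferentiableAt ℝ f x :=
    (hf.1.contDiffAt (hΩ.mem_nhds hx)).differentiableAt one_ne_zero
  have h := (Vq_eq_zero_iff _ (hΩ' hx)).1 (hf.2 x hx)
  rw [Vq_eq_zero_iff _ (hΩ' hx), fderiv_mul_const' hd]
  simp only [FunLike.coe_smul, Pi.smul_apply, MulOpposite.smul_eq_mul_unop,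
    MulOpposite.unop_op, h, mul_assoc]

theorem exists_summable_derivBound {s : ℍ[ℝ] → ℍ[ℝ]} (hs : VqRegularOn s OmegaA)
    {c : (Fin 3 → ℕ) → ℍ[ℝ]} (hc : Summable fun α => (weight α)⁻¹ * ‖c α‖ ^ 2) {x : ℍ[ℝ]}
    (hx : x ∈ OmegaA) : ∃ r > 0, Metric.ball x r ⊆ OmegaA ∧
      ∃ v : (Fin 3 → ℕ) → ℝ, Summable v ∧ ∀ α, ∀ y ∈ Metric.ball x r,
        ∃ a k M, DerivBound (fun x => muPow α x * s x * c α) y a k M ∧ k * a * M ≤ v α := by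
  obtain ⟨b, hb, hb1⟩ := exists_bounds_of_mem_OmegaA hx
  have hmu : ∀ u, ContDiffOn ℝ 1 (mu u) OmegaA := fun u =>
    (contDiffOn_mu u).mono OmegaA_subset_Hstar
  choose M₀ hM₀ using fun u => eventually_derivBound isOpen_OmegaA (hmu u) hx (hb u)
  obtain ⟨M₁, hM₁⟩ := eventually_derivBound isOpen_OmegaA hs.1 hx (lt_add_one ‖s x‖)
  obtain ⟨M, hM⟩ := (Finset.univ.image M₀ ∪ {M₁}).exists_le
  have e0 : ∀ᶠ y in 𝓝 x, ∀ u, DerivBound (mu u) y (b u) 1 M :=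
    eventually_all.2 fun u => hM₀ u M (hM _ (by simp))
  have e1 := hM₁ M (hM _ (by simp))
  obtain ⟨r, hr, hball⟩ := Metric.eventually_nhds_iff_ball.1
    ((e0.and e1).and (isOpen_OmegaA.mem_nhds hx))
  refine ⟨r, hr, fun y hy => (hball y hy).2,
    fun α => (((∑ u, α u : ℕ) + 1 : ℝ) * ∏ u, b u ^ α u) * ‖c α‖ * ((‖s x‖ + 1) * M), ?_, ?_⟩
  · exact (summable_mul_norm_of_weight weight_pos (summable_weight_mul_sq hb1) hc).mul_right _
  · intro α y hy
    obtain ⟨⟨h0, h1⟩, -⟩ := hball y hy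
    -- The monomial has degree `|α|`, the factor `s` degree `1` and the constant degree `0`: this is
    -- the `|α| + 1` of the majorant.
    have := ((((((h0 0).pow (α 0)).mul ((h0 1).pow (α 1))).mul ((h0 2).pow (α 2))).mul h1).mul
      (DerivBound.const (c α) y M))
    refine ⟨_, _, _, this, le_of_eq ?_⟩
    simp only [Fin.sum_univ_three, Fin.prod_univ_three]
    push_cast
    ring

theorem VqRegularOn.tsum_muPow {s : ℍ[ℝ] → ℍ[ℝ]} (hs : VqRegularOn s OmegaA)
    {c : (Fin 3 → ℕ) → ℍ[ℝ]} (hc : Summable fun α => (weight α)⁻¹ * ‖c α‖ ^ 2) :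
    VqRegularOn (fun x => ∑' α, muPow α x * s x * c α) OmegaA :=
  VqRegularOn.tsum isOpen_OmegaA OmegaA_subset_Hstar
    (fun α => (hs.muPow_mul α).mul_const isOpen_OmegaA OmegaA_subset_Hstar (c α))
    (fun x hx => (summable_muPow_mul hx (s x) hc).of_norm)
    (fun _ hx => exists_summable_derivBound hs hc hx)

/-! ### Uniqueness of CK-extensions by holomorphy on slices. -/

/-- The complex normed space structure of `ℍ` for which `Complex.I` acts as left multiplication
by an imaginary unit. -/
noncomputable abbrev sliceNormedSpace (I : ℍ[ℝ]) (hI : I * I = -1)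
    (hn : ∀ z : ℂ, ‖Complex.liftAux I hI z‖ = ‖z‖) : NormedSpace ℂ ℍ[ℝ] :=
  { Module.compHom ℍ[ℝ] (Complex.liftAux I hI).toRingHom with
    norm_smul_le := fun z q => by
      change ‖Complex.liftAux I hI z * q‖ ≤ _
      rw [norm_mul, hn] }

theorem eq_of_slice_holomorphic {E : Type*} [NormedAddCommGroup E] [NormedSpace ℂ E]
    [CompleteSpace E] {f g : ℂ → E} {U : Set ℂ} (hU : IsOpen U) (hc : Convex ℝ U)
    (hf : DifferentiableOn ℂ f U) (hg : DifferentiableOn ℂ g U) {t : ℝ}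
    (ht : (t : ℂ) * Complex.I ∈ U)
    (h : ∀ s : ℝ, (s : ℂ) * Complex.I ∈ U → f (s * Complex.I) = g (s * Complex.I)) :
    EqOn f g U := by
  refine (hf.analyticOnNhd hU).eqOn_of_preconnected_of_frequently_eq (hg.analyticOnNhd hU)
    hc.isPreconnected ht ?_
  have hcont : ContinuousAt (fun s : ℝ => (s : ℂ) * Complex.I) t := by fun_prop
  have htend : Tendsto (fun s : ℝ => (s : ℂ) * Complex.I) (𝓝[≠] t)
      (𝓝[≠] ((t : ℂ) * Complex.I)) := by
    refine tendsto_nhdsWithin_of_tendsto_nhds_of_eventually_within _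
      (hcont.tendsto.mono_left nhdsWithin_le_nhds) ?_
    filter_upwards [self_mem_nhdsWithin] with s hs
    simpa using hs
  refine htend.frequently (Eventually.frequently ?_)
  filter_upwards [(hcont.eventually (hU.mem_nhds ht)).filter_mono nhdsWithin_le_nhds] with s hs
  exact h s hs

theorem exists_imaginary_unit {x : ℍ[ℝ]} (hx : x.im ≠ 0) :
    ∃ I : ℍ[ℝ], I * I = -1 ∧ I.re = 0 ∧ ‖I‖ = 1 ∧ x.im = ‖x.im‖ • I := by
  have hr : ‖x.im‖ ≠ 0 := norm_ne_zero_iff.2 hx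
  refine ⟨‖x.im‖⁻¹ • x.im, ?_, ?_, ?_, ?_⟩
  · have h : x.im * x.im = (-(‖x.im‖ * ‖x.im‖)) • (1 : ℍ[ℝ]) := by
      rw [← sq, Quaternion.im_sq, Quaternion.normSq_eq_norm_mul_self,
        ← Quaternion.coe_mul_eq_smul, mul_one, Quaternion.coe_neg]
    rw [smul_mul_smul_comm, h, smul_smul]
    have : ‖x.im‖⁻¹ * ‖x.im‖⁻¹ * -(‖x.im‖ * ‖x.im‖) = -1 := by field_simp
    rw [this, neg_one_smul]
  · rw [Quaternion.re_smul, Quaternion.re_im, smul_zero]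
  · rw [norm_smul, norm_inv, norm_norm, inv_mul_cancel₀ hr]
  · rw [smul_smul, mul_inv_cancel₀ hr, one_smul]

/-- The half-slice through `x` is a half-disc on which both functions are holomorphic. Its points
with `x₀ = 0` form a segment of the imaginary axis, so the identity theorem applies. -/
theorem VqRegularOn.eqOn_of_eq_on_re_eq_zero {f g : ℍ[ℝ] → ℍ[ℝ]} (hf : VqRegularOn f OmegaA)
    (hg : VqRegularOn g OmegaA) (h : ∀ x ∈ OmegaA, x.re = 0 → f x = g x) :
    EqOn f g OmegaA := by
  intro x hx
  obtain ⟨hx0, hx1⟩ := mem_OmegaA.1 hx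
  have hr : 0 < ‖x.im‖ := norm_pos_iff.2 hx0
  obtain ⟨I, hI, hIre, hI1, hxI⟩ := exists_imaginary_unit hx0
  have hI0 : I ≠ 0 := fun h0 => by simp [h0] at hI
  have hι : ∀ z, Complex.liftAux I hI z = (z.re : ℍ[ℝ]) + z.im • I := fun z =>
    Complex.liftAux_apply I hI z
  have hιre : ∀ z, (Complex.liftAux I hI z).re = z.re := fun z => by
    rw [hι, Quaternion.re_add, Quaternion.re_coe, Quaternion.re_smul, hIre, smul_zero, add_zero]
  have hιim : ∀ z, (Complex.liftAux I hI z).im = z.im • I := fun z => by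
    rw [hι]; ext <;> simp [hIre]
  have hn : ∀ z, ‖Complex.liftAux I hI z‖ = ‖z‖ := by
    intro z
    have h1 : Quaternion.normSq I = 1 := by
      rw [Quaternion.normSq_eq_norm_mul_self, hI1, one_mul]
    rw [Quaternion.normSq_def', hIre] at h1
    rw [← sq_eq_sq₀ (norm_nonneg _) (norm_nonneg _), sq ‖Complex.liftAux I hI z‖,
      ← Quaternion.normSq_eq_norm_mul_self, Complex.sq_norm, Complex.normSq_apply,
      Quaternion.normSq_def', hι]
    simp only [Quaternion.re_add, Quaternion.imI_add, Quaternion.imJ_add, Quaternion.imK_add,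
      Quaternion.re_smul, Quaternion.imI_smul, Quaternion.imJ_smul, Quaternion.imK_smul,
      Quaternion.re_coe, Quaternion.imI_coe, Quaternion.imJ_coe, Quaternion.imK_coe, hIre,
      smul_eq_mul]
    linear_combination z.im ^ 2 * h1
  let _ : NormedSpace ℂ ℍ[ℝ] := sliceNormedSpace I hI hn
  have hsmul : ∀ (z : ℂ) (q : ℍ[ℝ]), z • q = Complex.liftAux I hI z * q := fun _ _ => rfl
  set U : Set ℂ := {z | 0 < z.im} ∩ Metric.ball 0 1 with hUdef
  have hU : IsOpen U := (isOpen_lt continuous_const Complex.continuous_im).inter Metric.isOpen_ball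
  have hmem : ∀ z ∈ U, Complex.liftAux I hI z ∈ OmegaA := by
    rintro z ⟨hz, hz1⟩
    rw [mem_OmegaA, hιim, hn]
    exact ⟨smul_ne_zero (ne_of_gt hz) hI0, by simpa using hz1⟩
  have hcont : Continuous (Complex.liftAux I hI) :=
    (LinearMap.continuous_of_finiteDimensional (Complex.liftAux I hI).toLinearMap)
  have hdiff : ∀ {F : ℍ[ℝ] → ℍ[ℝ]}, VqRegularOn F OmegaA →
      DifferentiableOn ℂ (fun z => F (Complex.liftAux I hI z)) U := by
    intro F hF z hz
    have hzΩ := hmem z hz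
    have hd := ((hF.1.contDiffAt (isOpen_OmegaA.mem_nhds hzΩ)).differentiableAt
      one_ne_zero).hasFDerivAt
    have hV := (Vq_eq_zero_iff F hzΩ.1).1 (hF.2 _ hzΩ)
    set D := fderiv ℝ F (Complex.liftAux I hI z)
    -- Cauchy–Riemann equation on the slice, after division by the positive length of the vector
    -- part.
    have hDI : D I = I * D 1 := by
      rw [hιim, map_smul, smul_mul_assoc] at hV
      exact smul_right_injective _ (ne_of_gt hz.1) hV
    have hDι : ∀ w, D (Complex.liftAux I hI w) = w • D 1 := by
      intro w
      have h1 : (w.re : ℍ[ℝ]) = w.re • (1 : ℍ[ℝ]) := by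
        rw [← Quaternion.coe_mul_eq_smul, mul_one]
      rw [hsmul, hι, h1, map_add, map_smul, map_smul, hDI, add_mul, smul_mul_assoc,
        smul_mul_assoc, one_mul]
    refine HasDerivAt.differentiableAt (f' := D 1) ?_ |>.differentiableWithinAt
    rw [hasDerivAt_iff_isLittleO]
    have ho := hd.isLittleO.comp_tendsto hcont.continuousAt
    refine (ho.congr_left fun w => ?_).trans_isBigO ?_
    · simp only [Function.comp_apply, ← map_sub, hDι]
    · refine Asymptotics.IsBigO.of_bound 1 (Eventually.of_forall fun w => ?_)
      simp only [Function.comp_apply, ← map_sub, hn, one_mul, le_refl]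
  have hxι : Complex.liftAux I hI ⟨x.re, ‖x.im‖⟩ = x := by
    rw [hι, ← hxI, Quaternion.re_add_im]
  have hxU : (⟨x.re, ‖x.im‖⟩ : ℂ) ∈ U :=
    ⟨hr, by rw [mem_ball_zero_iff, ← hn, hxι]; exact hx1⟩
  have key := eq_of_slice_holomorphic hU ((convex_halfSpace_im_gt 0).inter (convex_ball _ _))
    (hdiff hf) (hdiff hg) (t := 1 / 2) ?_ ?_ hxU
  · simpa only [hxι] using key
  · constructor
    · simp
    · simp
      norm_num
  · intro s hs
    exact h _ (hmem _ hs) (by rw [hιre]; simp)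

/-! ### The coefficient Hilbert space and its evaluation vectors. -/

/-- The Hilbert space of square summable families of columns; with normalised coefficients it is
the space `𝔄^p`. -/
abbrev CoeffSpace (p : ℕ) : Type :=
  lp (fun _ : Fin 3 → ℕ => PiLp 2 fun _ : Fin p => ℍ[ℝ]) 2

theorem memℓp_two_iff_summable_sq {ι : Type*} {E : ι → Type*} [∀ i, NormedAddCommGroup (E i)]
    {a : ∀ i, E i} : Memℓp a 2 ↔ Summable fun i => ‖a i‖ ^ 2 := by
  rw [memℓp_gen_iff (by simp)]
  simp

theorem hasSum_norm_sq_CoeffSpace {p : ℕ} (a : CoeffSpace p) :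
    HasSum (fun α => ‖a α‖ ^ 2) (‖a‖ ^ 2) := by
  have := lp.hasSum_inner (𝕜 := ℝ) a a
  simpa only [real_inner_self_eq_norm_sq] using this

theorem norm_sq_sqrt_weight_inv_smul {p : ℕ} (α : Fin 3 → ℕ) (c : Fin p → ℍ[ℝ]) :
    ‖(√(weight α))⁻¹ • WithLp.toLp 2 c‖ ^ 2 = (weight α)⁻¹ * ∑ i, ‖c i‖ ^ 2 := by
  rw [norm_smul, mul_pow, norm_inv, inv_pow, Real.norm_eq_abs, sq_abs,
    Real.sq_sqrt (weight_pos α).le, PiLp.norm_sq_eq_of_L2]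

theorem norm_sq_sqrt_weight_smul {p : ℕ} (α : Fin 3 → ℕ) (c : Fin p → ℍ[ℝ]) :
    ‖√(weight α) • WithLp.toLp 2 c‖ ^ 2 = weight α * ∑ i, ‖c i‖ ^ 2 := by
  rw [norm_smul, mul_pow, Real.norm_eq_abs, sq_abs,
    Real.sq_sqrt (weight_pos α).le, PiLp.norm_sq_eq_of_L2]

/-- The normalised coefficients of an element of `𝔄^p`. -/
noncomputable def Arveson.toLp {p : ℕ} (f : Arveson p) : CoeffSpace p :=
  ⟨fun α => (√(weight α))⁻¹ • WithLp.toLp 2 (f.coeff α), memℓp_two_iff_summable_sq.2 (by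
    simpa only [norm_sq_sqrt_weight_inv_smul] using f.summable_coeff)⟩

theorem Arveson.norm_sq_toLp {p : ℕ} (f : Arveson p) : ‖f.toLp‖ ^ 2 = f.normSq := by
  rw [← (hasSum_norm_sq_CoeffSpace f.toLp).tsum_eq]
  exact tsum_congr fun α => norm_sq_sqrt_weight_inv_smul α _

theorem Arveson.summable_coeff_apply {p : ℕ} {c : (Fin 3 → ℕ) → Fin p → ℍ[ℝ]}
    (hc : Summable fun α => (weight α)⁻¹ * ∑ i, ‖c α i‖ ^ 2) (i : Fin p) :
    Summable fun α => (weight α)⁻¹ * ‖c α i‖ ^ 2 := by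
  have hw := fun α => inv_pos.2 (weight_pos α)
  refine Summable.of_nonneg_of_le (fun α => mul_nonneg (hw α).le (sq_nonneg _)) (fun α => ?_) hc
  exact mul_le_mul_of_nonneg_left (Finset.single_le_sum (f := fun i => ‖c α i‖ ^ 2)
    (fun j _ => sq_nonneg _) (Finset.mem_univ i)) (hw α).le

/-- The element of `𝔄^p` with given normalised coefficients. -/
noncomputable def Arveson.ofLp {p : ℕ} (a : CoeffSpace p) : Arveson p :=
  have h : Summable fun α => (weight α)⁻¹ * ∑ i, ‖(√(weight α) • (a α).ofLp) i‖ ^ 2 := by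
    refine (hasSum_norm_sq_CoeffSpace a).summable.congr fun α => ?_
    rw [← norm_sq_sqrt_weight_inv_smul, WithLp.toLp_smul, WithLp.toLp_ofLp,
      inv_smul_smul₀ (Real.sqrt_ne_zero'.2 (weight_pos α))]
  { coeff := fun α => √(weight α) • (a α).ofLp
    summable_coeff := h
    summable_series := fun x hx i => by
      simpa using summable_muPow_mul hx 1 (Arveson.summable_coeff_apply h i) }

theorem Arveson.toLp_ofLp {p : ℕ} (a : CoeffSpace p) : (Arveson.ofLp a).toLp = a := by
  ext α : 2
  change (√(weight α))⁻¹ • WithLp.toLp 2 (√(weight α) • (a α).ofLp) = a α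
  rw [WithLp.toLp_smul, WithLp.toLp_ofLp, inv_smul_smul₀ (Real.sqrt_ne_zero'.2 (weight_pos α))]

/-- The value at `x` of the image of `f` under the multiplier with value `A` at `x`. -/
noncomputable def Arveson.starEval {n p : ℕ} (f : Arveson p) (A : Matrix (Fin n) (Fin p) ℍ[ℝ])
    (x : ℍ[ℝ]) (i : Fin n) : ℍ[ℝ] :=
  ∑ j, ∑' α, muPow α x * A i j * f.coeff α j

theorem Arveson.starEval_one {p : ℕ} (f : Arveson p) (x : ℍ[ℝ]) :
    f.starEval 1 x = f.eval x := by
  funext i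
  rw [starEval, Finset.sum_eq_single i, eval]
  · simp
  · intro j _ hj
    simp [Matrix.one_apply_ne' hj]
  · simp

theorem summable_kernel_coeff {n p : ℕ} (A : Matrix (Fin n) (Fin p) ℍ[ℝ]) {x : ℍ[ℝ]}
    (hx : x ∈ OmegaA) (ξ : Fin n → ℍ[ℝ]) :
    Summable fun α => weight α * ∑ j, ‖((muPow α x • A)ᴴ *ᵥ ξ) j‖ ^ 2 := by
  refine Summable.of_nonneg_of_le (fun α => mul_nonneg (weight_pos α).le
    (Finset.sum_nonneg fun j _ => sq_nonneg _)) (fun α => ?_)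
    ((summable_weight_mul_norm_sq hx).mul_right (∑ j, (∑ i, ‖A i j‖ * ‖ξ i‖) ^ 2))
  rw [mul_assoc]
  refine mul_le_mul_of_nonneg_left ?_ (weight_pos α).le
  rw [Finset.mul_sum]
  refine Finset.sum_le_sum fun j _ => ?_
  rw [← mul_pow]
  refine pow_le_pow_left₀ (norm_nonneg _) ?_ 2
  rw [Finset.mul_sum]
  rw [Matrix.mulVec, dotProduct]
  refine (norm_sum_le _ _).trans (Finset.sum_le_sum fun i _ => ?_)
  simp [Matrix.conjTranspose_apply, mul_assoc, mul_comm]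

/-- The element of the coefficient space that represents `f ↦ ⟨ξ, (A ⋆ f)(x)⟩`. -/
noncomputable def kernelVec {n p : ℕ} (A : Matrix (Fin n) (Fin p) ℍ[ℝ]) (x : OmegaA)
    (ξ : Fin n → ℍ[ℝ]) : CoeffSpace p :=
  ⟨fun α => √(weight α) • WithLp.toLp 2 ((muPow α x • A)ᴴ *ᵥ ξ), memℓp_two_iff_summable_sq.2 (by
    simpa only [norm_sq_sqrt_weight_smul] using summable_kernel_coeff A x.2 ξ)⟩

theorem kernelVec_smul {n p : ℕ} (A : Matrix (Fin n) (Fin p) ℍ[ℝ]) (x : OmegaA) (r : ℝ)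
    (ξ : Fin n → ℍ[ℝ]) : kernelVec A x (r • ξ) = r • kernelVec A x ξ := by
  ext α : 2
  change √(weight α) • WithLp.toLp 2 ((muPow α x • A)ᴴ *ᵥ (r • ξ)) =
    r • √(weight α) • WithLp.toLp 2 ((muPow α x • A)ᴴ *ᵥ ξ)
  rw [Matrix.mulVec_smul, WithLp.toLp_smul, smul_comm]

/-- Adjoint of left multiplication for the real inner product, the only inner product used on `ℍ`.
-/
theorem inner_star_mul (a c ξ : ℍ[ℝ]) : ⟪c, star a * ξ⟫ = ⟪a * c, ξ⟫ := by
  simp only [Quaternion.inner_def, Quaternion.re_mul, Quaternion.re_star, Quaternion.imI_star,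
    Quaternion.imJ_star, Quaternion.imK_star, Quaternion.imI_mul, Quaternion.imJ_mul,
    Quaternion.imK_mul]
  ring

theorem Arveson.inner_kernelVec {n p : ℕ} (f : Arveson p) (A : Matrix (Fin n) (Fin p) ℍ[ℝ])
    (x : OmegaA) (ξ : Fin n → ℍ[ℝ]) :
    ⟪f.toLp, kernelVec A x ξ⟫ = ∑ i, ⟪f.starEval A x i, ξ i⟫ := by
  refine (lp.hasSum_inner (𝕜 := ℝ) f.toLp (kernelVec A x ξ)).unique ?_
  have h : ∀ i j, HasSum (fun α => ⟪muPow α x * A i j * f.coeff α j, ξ i⟫)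
      ⟪∑' α, muPow α x * A i j * f.coeff α j, ξ i⟫ := fun i j =>
    ((summable_muPow_mul x.2 (A i j)
      (Arveson.summable_coeff_apply f.summable_coeff j)).of_norm.hasSum).mapL
      ((innerSL ℝ).flip (ξ i))
  have h2 := hasSum_sum (s := Finset.univ) fun i _ =>
    hasSum_sum (s := Finset.univ) fun j _ => h i j
  simp only [← sum_inner] at h2
  suffices key : ∀ α, ⟪f.toLp α, kernelVec A x ξ α⟫ =
      ∑ i, ⟪∑ j, muPow α x * A i j * f.coeff α j, ξ i⟫ by
    rw [funext key]
    exact h2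
  intro α
  change ⟪(√(weight α))⁻¹ • WithLp.toLp 2 (f.coeff α),
    √(weight α) • WithLp.toLp 2 ((muPow α x • A)ᴴ *ᵥ ξ)⟫ = _
  rw [real_inner_smul_left, real_inner_smul_right,
    inv_mul_cancel_left₀ (Real.sqrt_ne_zero'.2 (weight_pos α)), PiLp.inner_apply]
  simp only [sum_inner, Matrix.mulVec, dotProduct, inner_sum]
  rw [Finset.sum_comm]
  refine Finset.sum_congr rfl fun i _ => Finset.sum_congr rfl fun j _ => ?_
  rw [Matrix.conjTranspose_apply, Matrix.smul_apply, smul_eq_mul, inner_star_mul]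

/-! ### Explicit forms of the CK-products. -/

theorem VqRegularOn.sum {ι : Type*} (s : Finset ι) {f : ι → ℍ[ℝ] → ℍ[ℝ]} {Ω : Set ℍ[ℝ]}
    (hΩ : IsOpen Ω) (hf : ∀ i ∈ s, VqRegularOn (f i) Ω) :
    VqRegularOn (fun x => ∑ i ∈ s, f i x) Ω := by
  refine ⟨ContDiffOn.sum fun i hi => (hf i hi).1, fun x hx => ?_⟩
  have hd : ∀ i ∈ s, DifferentiableAt ℝ (f i) x := fun i hi =>
    ((hf i hi).1.contDiffAt (hΩ.mem_nhds hx)).differentiableAt one_ne_zero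
  have h : ∀ v, fderiv ℝ (fun x => ∑ i ∈ s, f i x) x v = ∑ i ∈ s, fderiv ℝ (f i) x v := by
    intro v
    rw [fderiv_fun_sum hd, _root_.sum_apply]
  have h2 : Vq (fun x => ∑ i ∈ s, f i x) x = ∑ i ∈ s, Vq (f i) x := by
    simp only [Vq, h, Finset.smul_sum, Finset.sum_sub_distrib, ← Finset.mul_sum]
    rw [Finset.sum_comm]
  rw [h2]
  exact Finset.sum_eq_zero fun i hi => (hf i hi).2 x hx

theorem IsCKExtension.eqOn {g F G : ℍ[ℝ] → ℍ[ℝ]} (hF : IsCKExtension g F)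
    (hG : IsCKExtension g G) : EqOn F G OmegaA :=
  hF.1.eqOn_of_eq_on_re_eq_zero hG.1 fun x hx h0 => (hF.2 x hx h0).trans (hG.2 x hx h0).symm

theorem isCKExtension_ckExtension {g F : ℍ[ℝ] → ℍ[ℝ]} (hF : IsCKExtension g F) :
    IsCKExtension g (ckExtension g) := by
  have h : ∃ F, IsCKExtension g F := ⟨F, hF⟩
  rw [ckExtension, dif_pos h]
  exact h.choose_spec

theorem isCKExtension_muPow_mul {s : ℍ[ℝ] → ℍ[ℝ]} (hs : VqRegularOn s OmegaA)
    (α : Fin 3 → ℕ) :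
    IsCKExtension (fun x => muPow α x * s x) (fun x => muPow α x * s x) :=
  ⟨hs.muPow_mul α, fun _ _ _ => rfl⟩

theorem starScalar_muPow {n m : ℕ} {S : ℍ[ℝ] → Matrix (Fin n) (Fin m) ℍ[ℝ]}
    (hS : ∀ i j, VqRegularOn (fun x => S x i j) OmegaA) (α : Fin 3 → ℕ) {x : ℍ[ℝ]}
    (hx : x ∈ OmegaA) : starScalar (muPow α) S x = muPow α x • S x := by
  ext1 i j
  have h := isCKExtension_muPow_mul (hS i j) α
  exact (isCKExtension_ckExtension h).eqOn h hx

theorem Arveson.isStarMulVec_starEval {n m : ℕ} {S : ℍ[ℝ] → Matrix (Fin n) (Fin m) ℍ[ℝ]}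
    (hS : ∀ i j, VqRegularOn (fun x => S x i j) OmegaA) (f : Arveson m) :
    IsStarMulVec S f.eval (fun x => f.starEval (S x) x) := by
  intro i
  refine ⟨VqRegularOn.sum _ isOpen_OmegaA fun j _ =>
    (hS i j).tsum_muPow (Arveson.summable_coeff_apply f.summable_coeff j), fun x hx h0 => ?_⟩
  simp only [starEval, Matrix.mulVec, dotProduct, eval]
  refine Finset.sum_congr rfl fun j _ => ?_
  rw [← tsum_mul_left]
  refine tsum_congr fun α => ?_
  -- A real monomial is central, so it can be moved past the entry of `S`.
  obtain ⟨r, hr⟩ := exists_muPow_eq_coe α h0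
  rw [hr, Quaternion.coe_commutes, mul_assoc]

/-! ### The kernel as a difference of squared norms. -/

theorem star_sum_mulVec_dotProduct {ι n p : Type*} [Fintype ι] [Fintype n] [Fintype p]
    (B : ι → Matrix n p ℍ[ℝ]) (ξ : ι → n → ℍ[ℝ]) :
    ∑ i, ∑ j, star (ξ i) ⬝ᵥ ((B i * (B j)ᴴ) *ᵥ ξ j) =
      ((∑ q, ‖(∑ j, (B j)ᴴ *ᵥ ξ j) q‖ ^ 2 : ℝ) : ℍ[ℝ]) := by
  have h1 : ∀ q : ℍ[ℝ], ((‖q‖ ^ 2 : ℝ) : ℍ[ℝ]) = star q * q := fun q => by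
    rw [Quaternion.star_mul_self, Quaternion.normSq_eq_norm_mul_self, sq]
  have h2 : ((∑ q, ‖(∑ j, (B j)ᴴ *ᵥ ξ j) q‖ ^ 2 : ℝ) : ℍ[ℝ]) =
      star (∑ j, (B j)ᴴ *ᵥ ξ j) ⬝ᵥ (∑ j, (B j)ᴴ *ᵥ ξ j) := by
    have h3 : ∀ r : ℝ, (r : ℍ[ℝ]) = algebraMap ℝ ℍ[ℝ] r := fun _ => rfl
    rw [h3, map_sum]
    simp only [← h3, h1]
    rfl
  rw [h2, star_sum, sum_dotProduct]
  refine Finset.sum_congr rfl fun i _ => ?_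
  rw [dotProduct_sum]
  refine Finset.sum_congr rfl fun j _ => ?_
  rw [Matrix.star_mulVec, Matrix.conjTranspose_conjTranspose, ← Matrix.dotProduct_mulVec,
    Matrix.mulVec_mulVec]

theorem summable_weight_mul_norm_mul_norm {x y : ℍ[ℝ]} (hx : x ∈ OmegaA) (hy : y ∈ OmegaA) :
    Summable fun α => weight α * (‖muPow α x‖ * ‖muPow α y‖) := by
  refine Summable.of_nonneg_of_le (fun α => mul_nonneg (weight_pos α).le (by positivity))
    (fun α => ?_) ((summable_weight_mul_norm_sq hx).add (summable_weight_mul_norm_sq hy))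
  rw [← mul_add]
  refine mul_le_mul_of_nonneg_left ?_ (weight_pos α).le
  nlinarith [sq_nonneg (‖muPow α x‖ - ‖muPow α y‖), sq_nonneg (‖muPow α x‖),
    sq_nonneg (‖muPow α y‖)]

theorem summable_weight_smul_mul_conjTranspose {n p : ℕ} (A B : Matrix (Fin n) (Fin p) ℍ[ℝ])
    {x y : ℍ[ℝ]} (hx : x ∈ OmegaA) (hy : y ∈ OmegaA) :
    Summable fun α => weight α • ((muPow α x • A) * (muPow α y • B)ᴴ) := by
  refine Pi.summable.2 fun i => Pi.summable.2 fun j => ?_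
  refine Summable.of_norm_bounded
    ((summable_weight_mul_norm_mul_norm hx hy).mul_right (∑ q, ‖A i q‖ * ‖B j q‖)) fun α => ?_
  rw [Matrix.smul_apply, Matrix.mul_apply, norm_smul, Real.norm_of_nonneg (weight_pos α).le,
    mul_assoc]
  refine mul_le_mul_of_nonneg_left ?_ (weight_pos α).le
  rw [Finset.mul_sum]
  refine (norm_sum_le _ _).trans (Finset.sum_le_sum fun q _ => ?_)
  simp only [Matrix.smul_apply, Matrix.conjTranspose_apply, smul_eq_mul, norm_mul, norm_star]
  exact (by ring : _ = _).le

theorem kernelTerm_eq {n m : ℕ} {S : ℍ[ℝ] → Matrix (Fin n) (Fin m) ℍ[ℝ]}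
    (hS : ∀ i j, VqRegularOn (fun x => S x i j) OmegaA) {x y : ℍ[ℝ]} (hx : x ∈ OmegaA)
    (hy : y ∈ OmegaA) (α : Fin 3 → ℕ) :
    kernelTerm S x y α =
      weight α • ((muPow α x • (1 : Matrix (Fin n) (Fin n) ℍ[ℝ])) *
        (muPow α y • (1 : Matrix (Fin n) (Fin n) ℍ[ℝ]))ᴴ) -
      weight α • ((muPow α x • S x) * (muPow α y • S y)ᴴ) := by
  have h : (muPow α y • (1 : Matrix (Fin n) (Fin n) ℍ[ℝ]))ᴴ =
      star (muPow α y) • (1 : Matrix (Fin n) (Fin n) ℍ[ℝ]) := by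
    ext1 i j
    rw [Matrix.conjTranspose_apply, Matrix.smul_apply, Matrix.smul_apply]
    by_cases hij : i = j
    · subst hij
      simp
    · simp [Matrix.one_apply_ne hij, Matrix.one_apply_ne' hij]
  have h' : (muPow α x • (1 : Matrix (Fin n) (Fin n) ℍ[ℝ])) *
      (star (muPow α y) • (1 : Matrix (Fin n) (Fin n) ℍ[ℝ])) =
      (muPow α x * star (muPow α y)) • (1 : Matrix (Fin n) (Fin n) ℍ[ℝ]) := by
    rw [Matrix.smul_mul, Matrix.one_mul, smul_smul]
  rw [kernelTerm, starScalar_muPow hS α hx, starScalar_muPow hS α hy, smul_sub, h, h']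

theorem summable_kernelTerm {n m : ℕ} {S : ℍ[ℝ] → Matrix (Fin n) (Fin m) ℍ[ℝ]}
    (hS : ∀ i j, VqRegularOn (fun x => S x i j) OmegaA) {x y : ℍ[ℝ]} (hx : x ∈ OmegaA)
    (hy : y ∈ OmegaA) : Summable (kernelTerm S x y) := by
  rw [funext (kernelTerm_eq hS hx hy)]
  exact (summable_weight_smul_mul_conjTranspose 1 1 hx hy).sub
    (summable_weight_smul_mul_conjTranspose _ _ hx hy)

theorem hasSum_quadratic_form {n p N : ℕ} (A : Fin N → Matrix (Fin n) (Fin p) ℍ[ℝ])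
    (x : Fin N → OmegaA) (ξ : Fin N → Fin n → ℍ[ℝ]) :
    HasSum (fun α => ∑ i, ∑ j, star (ξ i) ⬝ᵥ
      ((weight α • ((muPow α (x i) • A i) * (muPow α (x j) • A j)ᴴ)) *ᵥ ξ j))
      ((‖∑ j, kernelVec (A j) (x j) (ξ j)‖ ^ 2 : ℝ) : ℍ[ℝ]) := by
  convert Quaternion.hasSum_coe.2
    (hasSum_norm_sq_CoeffSpace (∑ j, kernelVec (A j) (x j) (ξ j))) using 1
  funext α
  have h : (∑ j, kernelVec (A j) (x j) (ξ j) : CoeffSpace p) α =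
      √(weight α) • WithLp.toLp 2 (∑ j, (muPow α (x j) • A j)ᴴ *ᵥ ξ j) := by
    rw [lp.coeFn_sum, Finset.sum_apply, WithLp.toLp_sum, Finset.smul_sum]
    rfl
  rw [h, norm_sq_sqrt_weight_smul, Quaternion.coe_mul, ← star_sum_mulVec_dotProduct,
    Quaternion.coe_mul_eq_smul]
  simp only [Finset.smul_sum, Matrix.smul_mulVec, dotProduct_smul]

/-- Each of the two halves of the kernel is a Gram kernel. The form is automatically real, which is
why real Hilbert space arguments suffice. -/
theorem kernel_quadratic_form {n m N : ℕ} {S : ℍ[ℝ] → Matrix (Fin n) (Fin m) ℍ[ℝ]}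
    (hS : ∀ i j, VqRegularOn (fun x => S x i j) OmegaA)
    (x : Fin N → OmegaA) (ξ : Fin N → Fin n → ℍ[ℝ]) :
    ∑ i, ∑ j, star (ξ i) ⬝ᵥ (kernel S (x i) (x j) *ᵥ ξ j) =
      ((‖∑ j, kernelVec (p := n) 1 (x j) (ξ j)‖ ^ 2 - ‖∑ j, kernelVec (S (x j)) (x j) (ξ j)‖ ^ 2 : ℝ) :
        ℍ[ℝ]) := by
  have h1 := (hasSum_quadratic_form (p := n) (fun _ => 1) x ξ).sub
    (hasSum_quadratic_form (fun i => S (x i)) x ξ)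
  rw [← Quaternion.coe_sub] at h1
  have h2 : ∀ i j, HasSum (fun α => star (ξ i) ⬝ᵥ (kernelTerm S (x i) (x j) α *ᵥ ξ j))
      (star (ξ i) ⬝ᵥ (kernel S (x i) (x j) *ᵥ ξ j)) := by
    intro i j
    let Φ : Matrix (Fin n) (Fin n) ℍ[ℝ] →+ ℍ[ℝ] :=
      { toFun := fun M => star (ξ i) ⬝ᵥ (M *ᵥ ξ j)
        map_zero' := by simp
        map_add' := fun M M' => by rw [Matrix.add_mulVec, dotProduct_add] }
    have hΦ : Continuous Φ :=
      Continuous.dotProduct continuous_const (continuous_id.matrix_mulVec continuous_const)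
    exact (summable_kernelTerm hS (x i).2 (x j).2).hasSum.map Φ hΦ
  have h3 := hasSum_sum (s := Finset.univ) fun i _ =>
    hasSum_sum (s := Finset.univ) fun j _ => h2 i j
  simp only [kernelTerm_eq hS (x _).2 (x _).2, Matrix.sub_mulVec, dotProduct_sub,
    Finset.sum_sub_distrib] at h3
  exact h3.unique h1

theorem isPositiveDefiniteOn_kernel_iff {n m : ℕ} {S : ℍ[ℝ] → Matrix (Fin n) (Fin m) ℍ[ℝ]}
    (hS : ∀ i j, VqRegularOn (fun x => S x i j) OmegaA) :
    IsPositiveDefiniteOn OmegaA (kernel S) ↔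
      ∀ (N : ℕ) (x : Fin N → OmegaA) (ξ : Fin N → Fin n → ℍ[ℝ]),
        ‖∑ j, kernelVec (S (x j)) (x j) (ξ j)‖ ≤ ‖∑ j, kernelVec (p := n) 1 (x j) (ξ j)‖ := by
  constructor
  · intro h N x ξ
    obtain ⟨r, hr, h⟩ := h N (fun i => x i) (fun i => (x i).2) ξ
    rw [kernel_quadratic_form hS x ξ, Quaternion.coe_inj] at h
    exact le_of_sq_le_sq (by linarith) (norm_nonneg _)
  · intro h N x hx ξ
    refine ⟨_, ?_, kernel_quadratic_form hS (fun i => ⟨x i, hx i⟩) ξ⟩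
    have := pow_le_pow_left₀ (norm_nonneg _) (h N (fun i => ⟨x i, hx i⟩) ξ) 2
    exact sub_nonneg.2 this

/-! ### Duality between multipliers and kernel inequalities. -/

/-- Let `f` have normalised coefficients `v`, the left-hand sum, and let `k` be its image. Then
`‖v‖² = ⟪k, g⟫ ≤ ‖v‖ ‖g‖`, where `g` is the right-hand sum. -/
theorem IsContractiveMultiplier.norm_sum_kernelVec_le {n m : ℕ}
    {S : ℍ[ℝ] → Matrix (Fin n) (Fin m) ℍ[ℝ]}
    (hS : ∀ i j, VqRegularOn (fun x => S x i j) OmegaA) (h : IsContractiveMultiplier S) {N : ℕ}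
    (x : Fin N → OmegaA) (ξ : Fin N → Fin n → ℍ[ℝ]) :
    ‖∑ j, kernelVec (S (x j)) (x j) (ξ j)‖ ≤ ‖∑ j, kernelVec (p := n) 1 (x j) (ξ j)‖ := by
  set v := ∑ j, kernelVec (S (x j)) (x j) (ξ j) with hv
  set g := ∑ j, kernelVec (p := n) 1 (x j) (ξ j) with hg
  obtain ⟨f, hf⟩ : ∃ f : Arveson m, f.toLp = v := ⟨_, Arveson.toLp_ofLp v⟩
  obtain ⟨k, hk, hkn⟩ := h f
  have heq : ∀ j, f.starEval (S (x j)) (x j) = k.starEval 1 (x j) := fun j => by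
    rw [Arveson.starEval_one]
    exact funext fun i => (f.isStarMulVec_starEval hS i).eqOn (hk i) (x j).2
  have h1 : ⟪v, v⟫ = ⟪k.toLp, g⟫ := by
    calc ⟪v, v⟫ = ⟪f.toLp, v⟫ := by rw [hf]
      _ = ⟪k.toLp, g⟫ := by
        rw [hv, hg, inner_sum, inner_sum]
        simp only [Arveson.inner_kernelVec, heq]
  rw [← k.norm_sq_toLp, ← f.norm_sq_toLp, hf] at hkn
  have h2 : ‖k.toLp‖ ≤ ‖v‖ := le_of_sq_le_sq hkn (norm_nonneg _)
  have h3 := real_inner_le_norm k.toLp g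
  rw [← h1, real_inner_self_eq_norm_mul_norm] at h3
  by_contra! hlt
  have h4 := norm_nonneg g
  nlinarith

/-- The assignment `G v ↦ ⟪f, F v⟫` is well defined and bounded by `‖f‖` on the range of `G`;
Hahn–Banach extends it without increasing the norm, and Riesz represents it by `k`. -/
theorem exists_inner_eq_of_norm_le {V H H' : Type*} [AddCommGroup V] [Module ℝ V]
    [NormedAddCommGroup H] [InnerProductSpace ℝ H] [CompleteSpace H] [NormedAddCommGroup H']
    [InnerProductSpace ℝ H'] (G : V →ₗ[ℝ] H) (F : V →ₗ[ℝ] H') (h : ∀ v, ‖F v‖ ≤ ‖G v‖) (f : H') :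
    ∃ k : H, ‖k‖ ≤ ‖f‖ ∧ ∀ v, ⟪k, G v⟫ = ⟪f, F v⟫ := by
  have hker : LinearMap.ker G ≤ LinearMap.ker ((innerₗ H' f) ∘ₗ F) := by
    intro v hv
    have : ‖F v‖ ≤ 0 := by simpa [LinearMap.mem_ker.1 hv] using h v
    simp [norm_le_zero_iff.1 this]
  let T : LinearMap.range G →ₗ[ℝ] ℝ :=
    (LinearMap.ker G).liftQ ((innerₗ H' f) ∘ₗ F) hker ∘ₗ G.quotKerEquivRange.symm.toLinearMap
  have hT : ∀ v, T ⟨G v, LinearMap.mem_range_self G v⟩ = ⟪f, F v⟫ := by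
    intro v
    have : G.quotKerEquivRange.symm ⟨G v, LinearMap.mem_range_self G v⟩ =
        Submodule.Quotient.mk v := by
      rw [LinearEquiv.symm_apply_eq]
      rfl
    simp [T, this]
  let Tc : StrongDual ℝ (LinearMap.range G) := T.mkContinuous ‖f‖ (by
    rintro ⟨_, v, rfl⟩
    rw [hT]
    exact (norm_inner_le_norm f (F v)).trans
      (mul_le_mul_of_nonneg_left (h v) (norm_nonneg _)))
  obtain ⟨g, hg, hgn⟩ := exists_extension_norm_eq (LinearMap.range G) Tc
  refine ⟨(InnerProductSpace.toDual ℝ H).symm g, ?_, fun v => ?_⟩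
  · rw [LinearIsometryEquiv.norm_map, hgn]
    exact LinearMap.mkContinuous_norm_le _ (norm_nonneg _) _
  · rw [InnerProductSpace.toDual_symm_apply, hg ⟨G v, LinearMap.mem_range_self G v⟩]
    exact hT v

theorem VqRegularOn.congr {f g : ℍ[ℝ] → ℍ[ℝ]} {Ω : Set ℍ[ℝ]} (hΩ : IsOpen Ω)
    (hf : VqRegularOn f Ω) (h : EqOn g f Ω) : VqRegularOn g Ω := by
  refine ⟨hf.1.congr h, fun x hx => ?_⟩
  have he : fderiv ℝ g x = fderiv ℝ f x :=
    (h.eventuallyEq_of_mem (hΩ.mem_nhds hx)).fderiv_eq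
  have := hf.2 x hx
  rwa [Vq, ← he] at this

theorem IsStarMulVec.congr {n m : ℕ} {S : ℍ[ℝ] → Matrix (Fin n) (Fin m) ℍ[ℝ]}
    {f : ℍ[ℝ] → Fin m → ℍ[ℝ]} {h k : ℍ[ℝ] → Fin n → ℍ[ℝ]} (hh : IsStarMulVec S f h)
    (hk : EqOn k h OmegaA) : IsStarMulVec S f k := fun i =>
  ⟨(hh i).1.congr isOpen_OmegaA fun _ hx => congrFun (hk hx) i,
    fun x hx h0 => (congrFun (hk hx) i).trans ((hh i).2 x hx h0)⟩

/-- Real coefficients are absorbed into the vectors `ξ`, so the inequality for finite sums holds on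
the free space over pairs `(x, ξ)`. -/
theorem norm_linearCombination_kernelVec_le {n m : ℕ}
    {S : ℍ[ℝ] → Matrix (Fin n) (Fin m) ℍ[ℝ]}
    (h : ∀ (N : ℕ) (x : Fin N → OmegaA) (ξ : Fin N → Fin n → ℍ[ℝ]),
        ‖∑ j, kernelVec (S (x j)) (x j) (ξ j)‖ ≤ ‖∑ j, kernelVec (p := n) 1 (x j) (ξ j)‖)
    (v : OmegaA × (Fin n → ℍ[ℝ]) →₀ ℝ) :
    ‖Finsupp.linearCombination ℝ (fun q => kernelVec (S q.1) q.1 q.2) v‖ ≤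
      ‖Finsupp.linearCombination ℝ
        (fun q : OmegaA × (Fin n → ℍ[ℝ]) => kernelVec (p := n) 1 q.1 q.2) v‖ := by
  have hsum : ∀ {p : ℕ} (A : OmegaA → Matrix (Fin n) (Fin p) ℍ[ℝ]),
      Finsupp.linearCombination ℝ (fun q => kernelVec (A q.1) q.1 q.2) v =
        ∑ i, kernelVec (A (v.support.equivFin.symm i).1.1) (v.support.equivFin.symm i).1.1
          (v (v.support.equivFin.symm i) • (v.support.equivFin.symm i).1.2) := by
    intro p A
    simp only [kernelVec_smul]
    rw [v.support.equivFin.symm.sum_comp (fun q : v.support =>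
      v q • kernelVec (A q.1.1) q.1.1 q.1.2), Finsupp.linearCombination_apply, Finsupp.sum,
      ← Finset.sum_coe_sort v.support]
  rw [hsum fun x => S x, hsum fun _ => 1]
  exact h _ _ _

theorem isContractiveMultiplier_of_norm_sum_kernelVec_le {n m : ℕ}
    {S : ℍ[ℝ] → Matrix (Fin n) (Fin m) ℍ[ℝ]}
    (hS : ∀ i j, VqRegularOn (fun x => S x i j) OmegaA)
    (h : ∀ (N : ℕ) (x : Fin N → OmegaA) (ξ : Fin N → Fin n → ℍ[ℝ]),
        ‖∑ j, kernelVec (S (x j)) (x j) (ξ j)‖ ≤ ‖∑ j, kernelVec (p := n) 1 (x j) (ξ j)‖) :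
    IsContractiveMultiplier S := by
  intro f
  obtain ⟨k, hk, hkv⟩ := exists_inner_eq_of_norm_le _ _
    (norm_linearCombination_kernelVec_le h) f.toLp
  refine ⟨Arveson.ofLp k, (f.isStarMulVec_starEval hS).congr fun x hx => ?_, ?_⟩
  · have hξ : ∀ ξ : Fin n → ℍ[ℝ],
        ∑ i, ⟪(Arveson.ofLp k).eval x i - f.starEval (S x) x i, ξ i⟫ = 0 := by
      intro ξ
      -- A single generator recovers the pairing of the value at `x` with `ξ`.
      have := hkv (Finsupp.single (⟨x, hx⟩, ξ) 1)
      simp only [Finsupp.linearCombination_single, one_smul] at this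
      rw [← Arveson.toLp_ofLp k, Arveson.inner_kernelVec, Arveson.inner_kernelVec,
        Arveson.starEval_one] at this
      simp only [inner_sub_left, Finset.sum_sub_distrib, sub_eq_zero]
      exact this
    -- With `ξ` equal to the difference itself, the pairing becomes a sum of squares.
    have h0 := hξ fun i => (Arveson.ofLp k).eval x i - f.starEval (S x) x i
    rw [Finset.sum_eq_zero_iff_of_nonneg fun i _ => real_inner_self_nonneg] at h0
    exact funext fun i => sub_eq_zero.1 (inner_self_eq_zero.1 (h0 i (Finset.mem_univ i)))
  · rw [← Arveson.norm_sq_toLp, ← Arveson.norm_sq_toLp, Arveson.toLp_ofLp]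
    exact pow_le_pow_left₀ (norm_nonneg _) hk 2

end VqArveson

theorem mainTheorem5 (n m : ℕ) (S : ℍ[ℝ] → Matrix (Fin n) (Fin m) ℍ[ℝ])
    (hS : ∀ i j, VqArveson.VqRegularOn (fun x => S x i j) VqArveson.OmegaA) :
    -- the products `μ^α ⋆ S` exist on `Ω(𝔄)`
    (∀ α i j, VqArveson.IsCKExtension (fun x => VqArveson.muPow α x * S x i j)
      (fun x => VqArveson.starScalar (VqArveson.muPow α) S x i j)) ∧
    -- the series that defines the kernel converges
    (∀ x ∈ VqArveson.OmegaA, ∀ y ∈ VqArveson.OmegaA,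
      Summable (VqArveson.kernelTerm S x y)) ∧
    (VqArveson.IsContractiveMultiplier S ↔
      VqArveson.IsPositiveDefiniteOn VqArveson.OmegaA (VqArveson.kernel S)) := by
  refine ⟨fun α i j => VqArveson.isCKExtension_ckExtension
    (VqArveson.isCKExtension_muPow_mul (hS i j) α),
    fun x hx y hy => VqArveson.summable_kernelTerm hS hx hy, ?_⟩
  rw [VqArveson.isPositiveDefiniteOn_kernel_iff hS]
  exact ⟨fun h _ x ξ => h.norm_sum_kernelVec_le hS x ξ,
    VqArveson.isContractiveMultiplier_of_norm_sum_kernelVec_le hS⟩
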